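/- Let $G$ be a locally compact second countable group. A $G$-space $(X,\nu)$ is a standard Borel space $X$ with a measurable action $G\times X\to X$ and a probability measure $\nu$ whose class of null sets is preserved by the action. A $G$-map $\pi:(X,\nu)\to(Y,\eta)$ of $G$-spaces is a measurable map with $\pi_*\nu=\eta$ such that, for every $g\in G$, $\pi(gx)=g\pi(x)$ for $\nu$-almost every $x$. Its disintegration $D_\pi:Y\to P(X)$ is the $\eta$-almost everywhere unique measurable family of probability measures such that $D_\pi(y)$ is concentrated on $\pi^{-1}(y)$ for $\eta$-almost every $y$ and $\int_Y D_\pi(y)\,d\eta(y)=\nu$; a $D_\pi$ with these properties is called a version of the disintegration. For a measure $m$ on $X$ and $g \in G$ write $gm(E)=m(g^{-1}E)$. The $G$-map $\pi$ is relatively measure-preserving when for every $g\in G$, $D_\pi(gy)=gD_\pi(y)$ for $\eta$-almost every $y$. It is relatively contractive when, for every version $D_\pi$ of the disintegration and every measurable $E\subseteq X$, for $\eta$-almost every $y$ with $D_\pi(y)(E)>0$ there is a sequence $(g_n)$ in $G$ with $g_n^{-1}D_\pi(g_ny)(E)\to1$. Let $(X,\nu)$, $(Y,\eta)$, $(Z,\zeta)$,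 $(W,\rho)$ be $G$-spaces and let $\psi:(W,\rho)\to(X,\nu)$, $\tau:(W,\rho)\to(Y,\eta)$, $\pi:(X,\nu)\to(Z,\zeta)$, $\varphi:(Y,\eta)\to(Z,\zeta)$ be $G$-maps with $\pi\circ\psi=\varphi\circ\tau$ $\rho$-almost everywhere. Suppose that $\tau$ and $\pi$ are relatively measure-preserving and that $\psi$ and $\varphi$ are relatively contractive. Then the independent relative joining of $(X,\nu)$ and $(Y,\eta)$ over $(Z,\zeta)$, that is, $X\times Y$ with the diagonal action and the measure $$\int_Z D_\pi(z)\times D_\varphi(z)\,d\zeta(z),$$ is a $G$-space, and $(W,\rho)$ is $G$-isomorphic to it: there are $G$-maps in both directions between the two spaces that are inverse to each other almost everywhere. -/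

import Mathlib

open MeasureTheory ProbabilityTheory Filter Topology

namespace GSpaces

/-- `(X, ν)` is a `G`-space: `ν` is a probability measure, the action `G × X → X` is (jointly)
measurable, and `ν` is quasi-invariant. Applying `quasiInvariant` to `g` and to `g⁻¹` shows that
the action preserves the class of null sets. -/
structure IsGSpace (G : Type*) [Group G] [MeasurableSpace G] {X : Type*} [MeasurableSpace X]
    [MulAction G X] (ν : Measure X) : Prop where
  isProbabilityMeasure : IsProbabilityMeasure ν
  measurable_smul : Measurable (fun p : G × X => p.1 • p.2)
  quasiInvariant : ∀ g : G, Measure.QuasiMeasurePreserving (fun x : X => g • x) ν ν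

/-- `π : (X, ν) → (Y, η)` is a `G`-map: `π` is measurable, `π_* ν = η`, and for every `g`,
`π (g x) = g π(x)` for almost every `x`. -/
structure IsGMap (G : Type*) [Group G] {X Y : Type*} [MeasurableSpace X] [MeasurableSpace Y]
    [MulAction G X] [MulAction G Y] (π : X → Y) (ν : Measure X) (η : Measure Y) : Prop where
  measurePreserving : MeasurePreserving π ν η
  equivariant : ∀ g : G, ∀ᵐ x ∂ν, π (g • x) = g • π x

/-- `D` is (a version of) the disintegration of `ν` over `η` via `π`: a measurable family of
probability measures on `X` indexed by `Y`, with `D y` concentrated on the fibre `π ⁻¹' {y}` for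
almost every `y`, and with `∫ D y dη(y) = ν`. On standard Borel spaces it exists (see
`exists_isDisintegration`), and any two versions agree almost everywhere. -/
structure IsDisintegration {X Y : Type*} [MeasurableSpace X] [MeasurableSpace Y]
    (π : X → Y) (ν : Measure X) (η : Measure Y) (D : Kernel Y X) : Prop where
  isMarkovKernel : IsMarkovKernel D
  fibre : ∀ᵐ y ∂η, D y (π ⁻¹' {y})ᶜ = 0
  integral_eq : η.bind D = ν

theorem exists_isDisintegration {X Y : Type*} [MeasurableSpace X] [MeasurableSpace Y]
    [StandardBorelSpace X] [StandardBorelSpace Y] {π : X → Y} {ν : Measure X} {η : Measure Y}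
    (hν : IsProbabilityMeasure ν) (hπ : MeasurePreserving π ν η) :
    ∃ D : Kernel Y X, IsDisintegration π ν η D := by
  have : Nonempty X := nonempty_of_isProbabilityMeasure ν
  have hη : IsProbabilityMeasure η := hπ.map_eq ▸ Measure.isProbabilityMeasure_map hπ.aemeasurable
  have key : η ⊗ₘ condDistrib id π ν = ν.map (fun x => (π x, x)) := by
    have h := compProd_map_condDistrib (mβ := inferInstance) (X := π) (μ := ν) (Y := id)
      aemeasurable_id
    rw [hπ.map_eq] at h
    exact h
  have hm : Measurable (fun x => (π x, x)) := hπ.measurable.prodMk measurable_id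
  refine ⟨condDistrib id π ν, inferInstance, ?_, ?_⟩
  · have h : ∀ᵐ p ∂(η ⊗ₘ condDistrib id π ν), π p.2 = p.1 := by
      have hs : MeasurableSet {p : Y × X | π p.2 = p.1} :=
        measurableSet_eq_fun (hπ.measurable.comp measurable_snd) measurable_fst
      rw [key, ae_map_iff hm.aemeasurable hs]
      exact Eventually.of_forall fun _ => rfl
    filter_upwards [Measure.ae_ae_of_ae_compProd h] with y hy
    exact hy
  · have h := condDistrib_comp_map (X := π) (μ := ν) (Y := id) hπ.aemeasurable aemeasurable_id
    rw [hπ.map_eq, Measure.map_id] at h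
    exact h

/-- `π` is relatively measure-preserving: its disintegration is `G`-equivariant, i.e. for every
`g`, `D (g y) = g D(y)` for almost every `y`. -/
def IsRelMeasurePreserving (G : Type*) [Group G] {X Y : Type*} [MeasurableSpace X]
    [MeasurableSpace Y] [MulAction G X] [MulAction G Y]
    (π : X → Y) (ν : Measure X) (η : Measure Y) : Prop :=
  ∀ D : Kernel Y X, IsDisintegration π ν η D →
    ∀ g : G, ∀ᵐ y ∂η, D (g • y) = (D y).map (fun x => g • x)

/-- `π` is relatively contractive: for every measurable `E` and almost every `y` with
`D(y)(E) > 0` there is a sequence `g n` in `G` with `(g n)⁻¹ D(g n y)(E) → 1`. Whether this holds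
for a given `D` can change when `D` is changed on an `η`-null set (which may meet every orbit), so
it is required of every version `D` of the disintegration. -/
def IsRelContractive (G : Type*) [Group G] {X Y : Type*} [MeasurableSpace X]
    [MeasurableSpace Y] [MulAction G X] [MulAction G Y]
    (π : X → Y) (ν : Measure X) (η : Measure Y) : Prop :=
  ∀ D : Kernel Y X, IsDisintegration π ν η D →
    ∀ E : Set X, MeasurableSet E → ∀ᵐ y ∂η, 0 < D y E →
      ∃ g : ℕ → G, Tendsto (fun n => (D (g n • y)).map (fun x => (g n)⁻¹ • x) E) atTop (𝓝 1)

/-- The independent relative joining `∫ D_π(z) × D_φ(z) dζ(z)`, a measure on `X × Y`. -/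
noncomputable def indepRelJoining {X Y Z : Type*} [MeasurableSpace X] [MeasurableSpace Y]
    [MeasurableSpace Z] (Dπ : Kernel Z X) (Dφ : Kernel Z Y) (ζ : Measure Z) : Measure (X × Y) :=
  ζ.bind (fun z => (Dπ z).prod (Dφ z))

/-- `(X, ν)` and `(Y, η)` are `G`-isomorphic: there are `G`-maps in both directions which are
inverse to each other almost everywhere. -/
def GIsomorphic (G : Type*) [Group G] {X Y : Type*} [MeasurableSpace X] [MeasurableSpace Y]
    [MulAction G X] [MulAction G Y] (ν : Measure X) (η : Measure Y) : Prop :=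
  ∃ (f : X → Y) (f' : Y → X), IsGMap G f ν η ∧ IsGMap G f' η ν ∧
    (∀ᵐ x ∂ν, f' (f x) = x) ∧ (∀ᵐ y ∂η, f (f' y) = y)

end GSpaces

/-! The engine is a rigidity principle, `IsRelContractive.ae_eq_of_bind_eq`: over a relatively
contractive extension, two equivariant families `κ₁`, `κ₂` of probability measures with the same
average over almost every fibre agree. If `κ₂(A) ≤ u < v ≤ κ₁(A)` on a set `E` charged by a fibre
measure, contractivity yields translated fibre measures giving `E` mass tending to 1. By
equivariance the averages over these translates still agree, so in the limit `v ≤ u`, a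
contradiction.

It is used twice. Over `φ`, the families `y ↦ ψ_* Dτ(y)` and `y ↦ Dπ(φ y)` both average to `Dπ(z)`,
so they coincide; this says that `q = (ψ, τ)` has the independent relative joining as its law. Over
`ψ`, let `D` disintegrate `ρ` along `q`. It is equivariant because `τ` is relatively
measure-preserving and factors through `q`. The families `w ↦ D(q w)` and `w ↦ δ_w` both average to
`Dψ(x)`, so `D(q w) = δ_w` and `q` is invertible almost everywhere. -/

namespace GSpaces

/-! ### Making almost everywhere equivariant kernels strictly equivariant. -/

section StrictEquivariance

/-- In a countably generated space, countably many measurable sets determine every probability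
measure. -/
theorem exists_countable_determining (T : Type*) [MeasurableSpace T]
    [MeasurableSpace.CountablyGenerated T] :
    ∃ C : Set (Set T), C.Countable ∧ (∀ s ∈ C, MeasurableSet s) ∧
      ∀ (μ μ' : Measure T) [IsProbabilityMeasure μ] [IsProbabilityMeasure μ'],
        (∀ s ∈ C, μ s = μ' s) → μ = μ' := by
  obtain ⟨b, hb, hgen⟩ := MeasurableSpace.CountablyGenerated.isCountablyGenerated (α := T)
  -- The generated algebra is still countable and is closed under intersections, as the π-system
  -- argument needs.
  rw [← generateFrom_generateSetAlgebra_eq] at hgen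
  refine ⟨generateSetAlgebra b, countable_generateSetAlgebra hb, fun s hs => ?_,
    fun μ μ' _ _ h => ?_⟩
  · exact hgen.symm.le s (MeasurableSpace.measurableSet_generateFrom hs)
  · exact ext_of_generate_finite _ hgen (fun s hs t ht _ =>
      isSetAlgebra_generateSetAlgebra.inter_mem hs ht) h (by simp)

variable {α T : Type*} [MeasurableSpace α] [MeasurableSpace T]
  [MeasurableSpace.CountablyGenerated T]

theorem measurableSet_kernel_eq (κ₁ κ₂ : Kernel α T) [IsMarkovKernel κ₁] [IsMarkovKernel κ₂] :
    MeasurableSet {a | κ₁ a = κ₂ a} := by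
  obtain ⟨C, hC, hCm, hdet⟩ := exists_countable_determining T
  have : {a | κ₁ a = κ₂ a} = ⋂ s ∈ C, {a | κ₁ a s = κ₂ a s} := by
    ext a
    simp only [Set.mem_ofPred_eq, Set.mem_iInter]
    exact ⟨fun h s _ => by rw [h], hdet _ _⟩
  rw [this]
  exact MeasurableSet.biInter hC fun s hs =>
    measurableSet_eq_fun (κ₁.measurable_coe (hCm s hs)) (κ₂.measurable_coe (hCm s hs))

/-- One inequality is enough: for probability measures, passing to complements reverses it. -/
theorem ae_kernel_eq_of_forall_le {ρ : Measure α} (κ₁ κ₂ : Kernel α T)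
    [IsMarkovKernel κ₁] [IsMarkovKernel κ₂]
    (h : ∀ A, MeasurableSet A → ∀ᵐ a ∂ρ, κ₁ a A ≤ κ₂ a A) : ∀ᵐ a ∂ρ, κ₁ a = κ₂ a := by
  obtain ⟨C, hC, hCm, hdet⟩ := exists_countable_determining T
  have key : ∀ᵐ a ∂ρ, ∀ s ∈ C, κ₁ a s = κ₂ a s := by
    rw [ae_ball_iff hC]
    intro s hs
    filter_upwards [h s (hCm s hs), h sᶜ (hCm s hs).compl] with a h₁ h₂
    refine le_antisymm h₁ ?_
    rw [prob_compl_eq_one_sub (hCm s hs), prob_compl_eq_one_sub (hCm s hs)] at h₂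
    exact (ENNReal.sub_le_sub_iff_left prob_le_one ENNReal.one_ne_top).1 h₂
  filter_upwards [key] with a ha using hdet _ _ ha

variable {G W : Type*} [Group G] [TopologicalSpace G] [IsTopologicalGroup G]
  [LocallyCompactSpace G] [SecondCountableTopology G] [MeasurableSpace G] [BorelSpace G]
  [MeasurableSpace W] [MulAction G W] [MeasurableSMul₂ G W] [MulAction G T] [MeasurableSMul₂ G T]

variable (G) in
/-- A probability measure whose null sets are preserved by right translations. -/
theorem exists_rightQuasiInvariant_probability :
    ∃ μ : Measure G, IsProbabilityMeasure μ ∧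
      ∀ (h : G) (p : G → Prop), (∀ᵐ g ∂μ, p g) → ∀ᵐ g ∂μ, p (g * h) := by
  -- Right translations preserve the null sets of left Haar measure, and `toFinite` keeps those null
  -- sets.
  refine ⟨(Measure.haar : Measure G).toFinite, inferInstance, fun h p hp => ?_⟩
  rw [ae_toFinite] at hp ⊢
  exact (quasiMeasurePreserving_mul_right Measure.haar h).ae hp

/-- An almost everywhere equivariant Markov kernel agrees almost everywhere with one that is
strictly equivariant on a conull invariant set. -/
theorem exists_strictly_equivariant {ρ : Measure W} [SFinite ρ] (κ : Kernel W T)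
    [IsMarkovKernel κ] (hκ : ∀ g : G, ∀ᵐ w ∂ρ, κ (g • w) = (κ w).map (fun t => g • t)) :
    ∃ κ' : Kernel W T, IsMarkovKernel κ' ∧ (∀ᵐ w ∂ρ, κ' w = κ w) ∧
      ∃ S : Set W, MeasurableSet S ∧ (∀ᵐ w ∂ρ, w ∈ S) ∧
        ∀ w ∈ S, ∀ g : G, g • w ∈ S ∧ κ' (g • w) = (κ' w).map (fun t => g • t) := by
  obtain ⟨μ, hμ, hμr⟩ := exists_rightQuasiInvariant_probability G
  have hsm : Measurable (fun p : G × T => p.1 • p.2) := measurable_smul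
  have hact : Measurable (fun p : W × G => p.2 • p.1) := by fun_prop
  -- `K (w, g) = g⁻¹ κ(g w)` would not depend on `g` if `κ` were strictly equivariant. `κ'` averages
  -- it over `g`, and `S` will consist of the `w` for which it is constant for almost every `g`.
  let K : Kernel (W × G) T :=
    ((Kernel.deterministic (fun p : W × G => p.2⁻¹) (by fun_prop)) ×ₖ
      (κ.comap (fun p : W × G => p.2 • p.1) hact)).map (fun p : G × T => p.1 • p.2)
  have hKM : IsMarkovKernel K := Kernel.IsMarkovKernel.map _ hsm
  have hK : ∀ w g, K (w, g) = (κ (g • w)).map (fun t => g⁻¹ • t) := by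
    intro w g
    rw [Kernel.map_apply _ hsm, Kernel.prod_apply, Kernel.deterministic_apply, Kernel.comap_apply,
      Measure.dirac_prod, Measure.map_map hsm measurable_prodMk_left]
    rfl
  let κ' : Kernel W T := K ∘ₖ (Kernel.id ×ₖ Kernel.const W μ)
  have hκ' : ∀ w, κ' w = μ.bind (fun g => K (w, g)) := by
    intro w
    ext s hs
    rw [Kernel.comp_apply' _ _ _ hs, Kernel.prod_apply, Kernel.id_apply, Kernel.const_apply,
      Measure.dirac_prod, lintegral_map (K.measurable_coe hs) measurable_prodMk_left,
      Measure.bind_apply (f := fun g => K (w, g)) hs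
        (K.measurable.comp measurable_prodMk_left).aemeasurable]
  have hκ'M : IsMarkovKernel κ' := inferInstance
  have hconst : ∀ w (m : Measure T), (∀ᵐ g ∂μ, K (w, g) = m) → κ' w = m := by
    intro w m h
    rw [hκ', Measure.bind_congr_right h, Measure.bind_const, measure_univ, one_smul]
  have heqm : ∀ κ₀ : Kernel W T, IsMarkovKernel κ₀ →
      MeasurableSet {p : W × G | K p = κ₀ p.1} := fun κ₀ _ =>
    measurableSet_kernel_eq K (κ₀.comap Prod.fst measurable_fst)
  have hae : ∀ᵐ w ∂ρ, ∀ᵐ g ∂μ, K (w, g) = κ w := by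
    rw [Measure.ae_ae_comm (heqm κ inferInstance)]
    refine Eventually.of_forall fun g => ?_
    filter_upwards [hκ g] with w hw
    rw [hK, hw, Measure.map_map (measurable_const_smul _) (measurable_const_smul _)]
    simp [Function.comp_def]
  refine ⟨κ', hκ'M, ?_, {w | ∀ᵐ g ∂μ, K (w, g) = κ' w}, ?_, ?_, ?_⟩
  · filter_upwards [hae] with w hw using hconst w _ hw
  · have := measurable_measure_prodMk_left (ν := μ) (heqm κ' hκ'M).compl
    exact this (measurableSet_singleton 0)
  · filter_upwards [hae] with w hw
    have := hconst w _ hw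
    simpa [this] using hw
  · intro w hw h
    -- `K (h w, g) = h K (w, g h)`, so right quasi-invariance of `μ` transfers the constancy from
    -- `w` to `h w`.
    have key : ∀ᵐ g ∂μ, K (h • w, g) = (κ' w).map (fun t => h • t) := by
      filter_upwards [hμr h _ hw] with g hg
      rw [← hg, hK, hK, Measure.map_map (measurable_const_smul _) (measurable_const_smul _),
        mul_smul]
      simp [Function.comp_def, smul_smul]
    have := hconst _ _ key
    exact ⟨by simpa [this] using key, this⟩

end StrictEquivariance

/-! ### Rigidity of equivariant families over relatively contractive extensions. -/

section Rigidity

variable {W X : Type*} [MeasurableSpace W] [MeasurableSpace X] {ψ : W → X} {ρ : Measure W}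
  {ν : Measure X}

theorem IsDisintegration.congr {D D' : Kernel X W} (hD : IsDisintegration ψ ρ ν D)
    (hD' : IsMarkovKernel D') (h : ∀ᵐ x ∂ν, D' x = D x) : IsDisintegration ψ ρ ν D' where
  isMarkovKernel := hD'
  fibre := by
    filter_upwards [h, hD.fibre] with x hx hf
    rwa [hx]
  integral_eq := by rw [Measure.bind_congr_right h, hD.integral_eq]

/-- A property that holds for almost every fibre measure holds for all fibre measures of a suitable
version of the disintegration. -/
theorem IsDisintegration.exists_version_forall [NeZero ν] {D : Kernel X W}
    (hD : IsDisintegration ψ ρ ν D) {P : Measure W → Prop} (hP : ∀ᵐ x ∂ν, P (D x)) :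
    ∃ D' : Kernel X W, IsDisintegration ψ ρ ν D' ∧ ∀ x, P (D' x) := by
  classical
  have := hD.isMarkovKernel
  obtain ⟨x₀, hx₀⟩ := hP.exists
  have hB : MeasurableSet (toMeasurable ν {x | ¬ P (D x)}) := measurableSet_toMeasurable _ _
  -- On a measurable null set containing the bad points, one good fibre measure is substituted.
  refine ⟨Kernel.piecewise hB (Kernel.const X (D x₀)) D, hD.congr inferInstance ?_, fun x => ?_⟩
  · have h0 : ν (toMeasurable ν {x | ¬ P (D x)}) = 0 := by rw [measure_toMeasurable]; exact hP
    filter_upwards [compl_mem_ae_iff.2 h0] with x hx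
    rw [Kernel.piecewise_apply, if_neg hx]
  · rw [Kernel.piecewise_apply]
    split_ifs with hx
    · exact hx₀
    · by_contra h
      exact hx (subset_toMeasurable _ _ h)

theorem le_of_tendsto_one {u v : ENNReal} (hu : u ≠ ⊤) (hv : v ≠ ⊤) {a : ℕ → ENNReal}
    (ha : Tendsto a atTop (𝓝 1)) (h : ∀ n, v * a n ≤ u * a n + (1 - a n)) : v ≤ u := by
  have hb : Tendsto (fun n => 1 - a n) atTop (𝓝 0) := by
    simpa using ENNReal.Tendsto.sub (tendsto_const_nhds (x := (1 : ENNReal)) (f := atTop)) ha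
      (Or.inl ENNReal.one_ne_top)
  have h₁ := ENNReal.Tendsto.const_mul (a := v) ha (Or.inr hv)
  have h₂ := (ENNReal.Tendsto.const_mul (a := u) ha (Or.inr hu)).add hb
  simpa using le_of_tendsto_of_tendsto' h₁ h₂ h

variable {G T : Type*} [Group G] [MeasurableSpace G] [MeasurableSpace T]
  [MulAction G W] [MeasurableSMul₂ G W] [MulAction G X] [MulAction G T] [MeasurableSMul₂ G T]

theorem comp_map_smul_of_ae {κ : Kernel W T} {m : Measure W} {g : G}
    (h : ∀ᵐ w ∂m, κ (g • w) = (κ w).map (fun t => g • t)) :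
    (m.map (fun w => g • w)).bind κ = (m.bind κ).map (fun t => g • t) := by
  have hT : Measurable (fun t : T => g • t) := measurable_const_smul g
  ext A hA
  rw [Measure.bind_apply hA κ.aemeasurable, Measure.map_apply hT hA,
    Measure.bind_apply (hT hA) κ.aemeasurable,
    lintegral_map (κ.measurable_coe hA) (measurable_const_smul g)]
  refine lintegral_congr_ae ?_
  filter_upwards [h] with w hw
  rw [hw, Measure.map_apply hT hA]

/-- The two averages of the mass of `A` are compared by discarding `κ₁` off `E` and bounding `κ₂` by
1 there. As `m E → 1`, `le_of_tendsto_one` turns the bound into `v ≤ u`. -/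
theorem mul_measure_le_of_bind_eq {κ₁ κ₂ : Kernel W T} [IsMarkovKernel κ₂]
    {m : Measure W} [IsProbabilityMeasure m] (hm : m.bind κ₁ = m.bind κ₂) {A : Set T}
    (hA : MeasurableSet A) {E : Set W} (hE : MeasurableSet E) {u v : ENNReal}
    (h₁ : ∀ w ∈ E, v ≤ κ₁ w A) (h₂ : ∀ w ∈ E, κ₂ w A ≤ u) :
    v * m E ≤ u * m E + (1 - m E) := by
  calc v * m E = ∫⁻ _ in E, v ∂m := by rw [setLIntegral_const]
    _ ≤ ∫⁻ w in E, κ₁ w A ∂m := setLIntegral_mono' hE h₁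
    _ ≤ ∫⁻ w, κ₁ w A ∂m := setLIntegral_le_lintegral _ _
    _ = ∫⁻ w, κ₂ w A ∂m := by
      rw [← Measure.bind_apply hA κ₁.aemeasurable, hm, Measure.bind_apply hA κ₂.aemeasurable]
    _ = ∫⁻ w in E, κ₂ w A ∂m + ∫⁻ w in Eᶜ, κ₂ w A ∂m := (lintegral_add_compl _ hE).symm
    _ ≤ ∫⁻ _ in E, u ∂m + ∫⁻ _ in Eᶜ, 1 ∂m :=
      add_le_add (setLIntegral_mono' hE h₂) (lintegral_mono fun _ => prob_le_one)
    _ = u * m E + (1 - m E) := by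
      rw [setLIntegral_const, setLIntegral_const, one_mul, prob_compl_eq_one_sub hE]

variable [TopologicalSpace G] [IsTopologicalGroup G] [LocallyCompactSpace G]
  [SecondCountableTopology G] [BorelSpace G] [MeasurableSpace.CountablyGenerated T]

/-- Over a relatively contractive extension, an equivariant family of probability measures is
determined by its barycentres along the fibres. -/
theorem IsRelContractive.ae_eq_of_bind_eq [IsProbabilityMeasure ν] [SFinite ρ]
    (hψ : IsRelContractive G ψ ρ ν) {D : Kernel X W} (hD : IsDisintegration ψ ρ ν D)
    (κ₁ κ₂ : Kernel W T) [IsMarkovKernel κ₁] [IsMarkovKernel κ₂]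
    (h₁ : ∀ g : G, ∀ᵐ w ∂ρ, κ₁ (g • w) = (κ₁ w).map (fun t => g • t))
    (h₂ : ∀ g : G, ∀ᵐ w ∂ρ, κ₂ (g • w) = (κ₂ w).map (fun t => g • t))
    (hbary : ∀ᵐ x ∂ν, (D x).bind κ₁ = (D x).bind κ₂) : ∀ᵐ w ∂ρ, κ₁ w = κ₂ w := by
  obtain ⟨κ₁', _, hae₁, S₁, hS₁, hρ₁, hinv₁⟩ := exists_strictly_equivariant κ₁ h₁
  obtain ⟨κ₂', _, hae₂, S₂, hS₂, hρ₂, hinv₂⟩ := exists_strictly_equivariant κ₂ h₂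
  have hP : ∀ᵐ x ∂ν, (∀ᵐ w ∂(D x), w ∈ S₁ ∧ w ∈ S₂) ∧ (D x).bind κ₁' = (D x).bind κ₂' := by
    have hall := (hae₁.and hae₂).and (hρ₁.and hρ₂)
    rw [← hD.integral_eq] at hall
    filter_upwards [hbary, Measure.ae_ae_of_ae_comp hall] with x hx hall
    refine ⟨hall.mono fun w h => h.2, ?_⟩
    rw [Measure.bind_congr_right (hall.mono fun w h => h.1.1),
      Measure.bind_congr_right (hall.mono fun w h => h.1.2), hx]
  -- The contracting elements depend on `x`, so the points `g n • x` may lie in any given null set.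
  -- Hence a version whose fibre measures are all good; contractivity applies to every version.
  obtain ⟨D', hD', hP'⟩ := hD.exists_version_forall
    (P := fun m => (∀ᵐ w ∂m, w ∈ S₁ ∧ w ∈ S₂) ∧ m.bind κ₁' = m.bind κ₂') hP
  have := hD'.isMarkovKernel
  have hbind : ∀ (g : G) x, ((D' x).map (fun w => g • w)).bind κ₁' =
      ((D' x).map (fun w => g • w)).bind κ₂' := by
    intro g x
    rw [comp_map_smul_of_ae ((hP' x).1.mono fun w h => (hinv₁ w h.1 g).2),
      comp_map_smul_of_ae ((hP' x).1.mono fun w h => (hinv₂ w h.2 g).2), (hP' x).2]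
  have hnull : ∀ A, MeasurableSet A → ∀ u v : ENNReal, u ≠ ⊤ → v ≠ ⊤ → u < v →
      ∀ᵐ w ∂ρ, ¬ (κ₂' w A ≤ u ∧ v ≤ κ₁' w A) := by
    intro A hA u v hu hv huv
    have hE : MeasurableSet {w | κ₂' w A ≤ u ∧ v ≤ κ₁' w A} :=
      (measurableSet_le (κ₂'.measurable_coe hA) measurable_const).inter
        (measurableSet_le measurable_const (κ₁'.measurable_coe hA))
    rw [← hD'.integral_eq]
    refine Measure.ae_comp_of_ae_ae hE.compl ?_
    filter_upwards [hψ D' hD' _ hE] with x hx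
    by_contra hpos
    obtain ⟨g, hg⟩ := hx (pos_iff_ne_zero.2 fun h => hpos (by rw [ae_iff]; simpa using h))
    refine huv.not_ge (le_of_tendsto_one hu hv hg fun n => ?_)
    have : IsProbabilityMeasure ((D' (g n • x)).map (fun w => (g n)⁻¹ • w)) :=
      Measure.isProbabilityMeasure_map (measurable_const_smul _).aemeasurable
    exact mul_measure_le_of_bind_eq (hbind _ _) hA hE (fun w h => h.2) (fun w h => h.1)
  have hfinal : ∀ᵐ w ∂ρ, κ₁' w = κ₂' w := by
    refine ae_kernel_eq_of_forall_le κ₁' κ₂' fun A hA => ?_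
    have : ∀ᵐ w ∂ρ, ∀ p q : ℚ, ENNReal.ofReal p < ENNReal.ofReal q →
        ¬ (κ₂' w A ≤ ENNReal.ofReal p ∧ ENNReal.ofReal q ≤ κ₁' w A) := by
      simp only [ae_all_iff]
      exact fun p q hpq => hnull A hA _ _ ENNReal.ofReal_ne_top ENNReal.ofReal_ne_top hpq
    filter_upwards [this] with w hw
    by_contra! hlt
    obtain ⟨q, -, hq₁, hq₂⟩ := ENNReal.lt_iff_exists_rat_btwn.1 hlt
    obtain ⟨p, -, hp₁, hp₂⟩ := ENNReal.lt_iff_exists_rat_btwn.1 hq₁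
    exact hw p q hp₂ ⟨hp₁.le, hq₂.le⟩
  filter_upwards [hae₁, hae₂, hfinal] with w h h' h''
  rw [← h, ← h', h'']

end Rigidity

/-! ### Uniqueness of disintegrations and towers of quotients. -/

section Disintegration

variable {W V X : Type*} [MeasurableSpace W] [MeasurableSpace V] [MeasurableSpace X]
  {ρ : Measure W} {α : Measure V} {ξ : Measure X} {q : W → V} {p : W → X}

theorem IsDisintegration.ae_ae {D : Kernel V W} (hD : IsDisintegration q ρ α D) {P : W → Prop}
    (h : ∀ᵐ w ∂ρ, P w) : ∀ᵐ v ∂α, ∀ᵐ w ∂(D v), P w := by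
  rw [← hD.integral_eq] at h
  exact Measure.ae_ae_of_ae_comp h

theorem IsDisintegration.ae_eq_fibre {D : Kernel V W} (hD : IsDisintegration q ρ α D) :
    ∀ᵐ v ∂α, ∀ᵐ w ∂(D v), q w = v := by
  filter_upwards [hD.fibre] with v hv using hv

theorem IsDisintegration.compProd_eq [IsFiniteMeasure α] {D : Kernel V W}
    (hD : IsDisintegration q ρ α D) (hq : Measurable q) :
    α ⊗ₘ D = ρ.map (fun w => (q w, w)) := by
  have := hD.isMarkovKernel
  have hm : Measurable (fun w => (q w, w)) := hq.prodMk measurable_id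
  refine Measure.ext_prod fun {B A} hB hA => ?_
  rw [Measure.compProd_apply_prod hB hA,
    Measure.map_apply hm (hB.prod hA), ← hD.integral_eq,
    Measure.bind_apply (hm (hB.prod hA)) D.aemeasurable, ← lintegral_indicator hB]
  refine lintegral_congr_ae ?_
  filter_upwards [hD.ae_eq_fibre] with v hv
  by_cases hvB : v ∈ B
  · rw [Set.indicator_of_mem hvB]
    refine measure_congr ?_
    filter_upwards [hv] with w hw
    exact propext ⟨fun h => ⟨by simpa [hw] using hvB, h⟩, fun h => h.2⟩
  · rw [Set.indicator_of_notMem hvB]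
    refine (measure_eq_zero_iff_ae_notMem.2 ?_).symm
    filter_upwards [hv] with w hw h
    exact hvB (hw ▸ h.1)

theorem IsDisintegration.ae_unique [IsFiniteMeasure α] [MeasurableSpace.CountablyGenerated W]
    {D D' : Kernel V W} (hD : IsDisintegration q ρ α D) (hD' : IsDisintegration q ρ α D')
    (hq : Measurable q) : ∀ᵐ v ∂α, D v = D' v := by
  have := hD.isMarkovKernel
  have := hD'.isMarkovKernel
  exact Kernel.ae_eq_of_compProd_eq ((hD.compProd_eq hq).trans (hD'.compProd_eq hq).symm)

/-- Averaging the disintegration over a finer quotient recovers the disintegration over a coarser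
one. -/
theorem IsDisintegration.bind_comap_eq [IsFiniteMeasure ξ] [MeasurableSpace.CountablyGenerated W]
    [MeasurableSingletonClass X] {r : V → X}
    (hq : MeasurePreserving q ρ α) (hp : MeasurePreserving (r ∘ q) ρ ξ)
    {Dq : Kernel V W} {Dp : Kernel X W} (hDq : IsDisintegration q ρ α Dq)
    (hDp : IsDisintegration (r ∘ q) ρ ξ Dp) :
    ∀ᵐ x ∂ξ, (Dp x).bind (Dq.comap q hq.measurable) = Dp x := by
  have := hDq.isMarkovKernel
  have := hDp.isMarkovKernel
  have key : IsDisintegration (r ∘ q) ρ ξ (Dq.comap q hq.measurable ∘ₖ Dp) := by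
    refine ⟨inferInstance, ?_, ?_⟩
    · filter_upwards [hDp.ae_eq_fibre,
        hDp.ae_ae (hq.quasiMeasurePreserving.ae hDq.ae_eq_fibre)] with x hx hx'
      refine Kernel.ae_comp_of_ae_ae (p := fun w => (r ∘ q) w = x)
        (hp.measurable (measurableSet_singleton x)) ?_
      filter_upwards [hx, hx'] with w hw hw'
      filter_upwards [hw'] with w' hw'
      rw [← hw, Function.comp_apply, hw', Function.comp_apply]
    · rw [← Measure.comp_assoc, hDp.integral_eq]
      calc ρ.bind (Dq.comap q hq.measurable) = (ρ.map q).bind Dq := by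
            ext s hs
            rw [Measure.bind_apply hs (Kernel.aemeasurable _), Measure.bind_apply hs Dq.aemeasurable,
              lintegral_map (Dq.measurable_coe hs) hq.measurable]
            rfl
        _ = ρ := by rw [hq.map_eq, hDq.integral_eq]
  filter_upwards [key.ae_unique hDp hp.measurable] with x hx
  rwa [Kernel.comp_apply] at hx

variable {G : Type*} [Group G] [MeasurableSpace G] [MulAction G W] [MeasurableSMul₂ G W]
  [MulAction G V] [MeasurableSMul₂ G V] [MulAction G X]

/-- If the composition `r ∘ q` is relatively measure-preserving, then so is `q`. -/
theorem IsRelMeasurePreserving.of_comp [IsFiniteMeasure ξ] [IsFiniteMeasure α]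
    [StandardBorelSpace W] [MeasurableSingletonClass V] [MeasurableSingletonClass X] {r : V → X}
    (hα : ∀ g : G, Measure.QuasiMeasurePreserving (fun v : V => g • v) α α)
    (hξ : ∀ g : G, Measure.QuasiMeasurePreserving (fun x : X => g • x) ξ ξ)
    (hq : IsGMap G q ρ α) (hp : MeasurePreserving (r ∘ q) ρ ξ)
    {Dp : Kernel X W} (hDp : IsDisintegration (r ∘ q) ρ ξ Dp)
    (hmp : IsRelMeasurePreserving G (r ∘ q) ρ ξ) : IsRelMeasurePreserving G q ρ α := by
  intro D hD g
  have := hD.isMarkovKernel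
  have hqm := hq.measurePreserving.measurable
  have hgV : Measurable (fun v : V => g • v) := measurable_const_smul g
  have hgW : Measurable (fun w : W => g • w) := measurable_const_smul g
  have hgW' : Measurable (fun w : W => g⁻¹ • w) := measurable_const_smul g⁻¹
  -- `D' v = g⁻¹ D(g v)` turns out to be another version of the disintegration, so uniqueness gives
  -- equivariance.
  let D' : Kernel V W := (D.comap (fun v => g • v) hgV).map (fun w => g⁻¹ • w)
  have hD'v : ∀ v, D' v = (D (g • v)).map (fun w => g⁻¹ • w) := fun v => by
    rw [Kernel.map_apply _ hgW', Kernel.comap_apply]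
  have hD' : IsDisintegration q ρ α D' := by
    refine ⟨Kernel.IsMarkovKernel.map _ hgW', ?_, ?_⟩
    · filter_upwards [(hα g).ae hD.ae_eq_fibre, (hα g).ae (hD.ae_ae (hq.equivariant g⁻¹))]
        with v hv hv'
      rw [hD'v, Measure.map_apply hgW' (hqm (measurableSet_singleton v)).compl]
      refine measure_eq_zero_iff_ae_notMem.2 ?_
      filter_upwards [hv, hv'] with w hw hw' h
      exact h (by simp [hw', hw])
    -- Equivariance of `Dp` moves the tower identity at `g x` back to `x`.
    · have hfib : ∀ᵐ x ∂ξ, (Dp x).bind (D'.comap q hqm) = Dp x := by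
        have htower := IsDisintegration.bind_comap_eq hq.measurePreserving hp hD hDp
        filter_upwards [hmp Dp hDp g, (hξ g).ae htower, hDp.ae_ae (hq.equivariant g)]
          with x hx hx' hx''
        calc (Dp x).bind (D'.comap q hqm)
            = (((Dp x).map (fun w => g • w)).bind (D.comap q hqm)).map (fun w => g⁻¹ • w) := by
              ext s hs
              rw [Measure.bind_apply hs (Kernel.aemeasurable _), Measure.map_apply hgW' hs,
                Measure.bind_apply (hgW' hs) (Kernel.aemeasurable _),
                lintegral_map (Kernel.measurable_coe _ (hgW' hs)) hgW]
              refine lintegral_congr_ae ?_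
              filter_upwards [hx''] with w hw
              rw [Kernel.comap_apply, Kernel.comap_apply, hD'v, Measure.map_apply hgW' hs, hw]
          _ = Dp x := by
              rw [← hx, hx', hx, Measure.map_map hgW' hgW]
              simp [Function.comp_def]
      calc α.bind D' = ρ.bind (D'.comap q hqm) := by
            rw [← hq.measurePreserving.map_eq]
            ext s hs
            rw [Measure.bind_apply hs (Kernel.aemeasurable _),
              Measure.bind_apply hs (Kernel.aemeasurable _),
              lintegral_map (Kernel.measurable_coe _ hs) hqm]
            rfl
        _ = ξ.bind (D'.comap q hqm ∘ₖ Dp) := by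
            rw [← Measure.comp_assoc, hDp.integral_eq]
        _ = ξ.bind Dp := Measure.bind_congr_right (by
            filter_upwards [hfib] with x hx
            rw [Kernel.comp_apply, hx])
        _ = ρ := hDp.integral_eq
  filter_upwards [hD.ae_unique hD' hqm] with v hv
  rw [hv, hD'v, Measure.map_map hgW hgW']
  simp [Function.comp_def]

end Disintegration

/-! ### The law of `(ψ, τ)` and its invertibility. -/

section Joining

/-- With `W` embedded in the real line, the mean of a point mass is the image of its point, and
means depend measurably on the kernel's parameter. -/
theorem exists_measurable_point {V W : Type*} [MeasurableSpace V] [MeasurableSpace W]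
    [StandardBorelSpace W] [Nonempty W] (D : Kernel V W) [IsMarkovKernel D] :
    ∃ f : V → W, Measurable f ∧ ∀ v w, D v = Measure.dirac w → f v = w := by
  have he := measurableEmbedding_embeddingReal W
  obtain ⟨e', he', hinv⟩ := he.exists_measurable_extend measurable_id fun _ => ‹Nonempty W›
  refine ⟨fun v => e' (∫ w, embeddingReal W w ∂(D v)), he'.comp ?_, fun v w h => ?_⟩
  · exact (he.measurable.stronglyMeasurable.integral_kernel (κ := D)).measurable
  · simp only [h, integral_dirac]
    exact congrFun hinv w

variable {G W X Y Z V : Type*} [Group G] [MeasurableSpace G]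
  [MeasurableSpace W] [MeasurableSpace V] [MeasurableSpace X] [MeasurableSpace Y]
  [MeasurableSpace Z] [MulAction G W] [MulAction G V] [MulAction G X] [MulAction G Y]
  [MulAction G Z]
  {ρ : Measure W} {α : Measure V} {ν : Measure X} {η : Measure Y} {ζ : Measure Z}

theorem IsGMap.isGSpace [MeasurableSMul₂ G V] [StandardBorelSpace V] {q : W → V}
    (hq : IsGMap G q ρ α) (hρ : IsGSpace G ρ) : IsGSpace G α where
  isProbabilityMeasure := by
    have := hρ.isProbabilityMeasure
    exact hq.measurePreserving.map_eq ▸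
      Measure.isProbabilityMeasure_map hq.measurePreserving.aemeasurable
  measurable_smul := measurable_smul
  quasiInvariant g := by
    refine ⟨measurable_const_smul g, Measure.AbsolutelyContinuous.mk fun s hs h => ?_⟩
    have hqm := hq.measurePreserving
    have hgs : MeasurableSet ((fun v : V => g • v) ⁻¹' s) := measurable_const_smul g hs
    rw [Measure.map_apply (measurable_const_smul g) hs, ← hqm.measure_preimage hgs.nullMeasurableSet,
      measure_eq_zero_iff_ae_notMem]
    rw [← hqm.measure_preimage hs.nullMeasurableSet, measure_eq_zero_iff_ae_notMem] at h
    filter_upwards [(hρ.quasiInvariant g).ae h, hq.equivariant g] with w hw hw' hmem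
    exact hw (by simpa [hw'] using hmem)

/-- Since `α` is the image of `ρ` under `q`, each property of `f` can be checked at the points `q
w`, where `f (q w) = w`. -/
theorem IsGMap.gIsomorphic [MeasurableSMul₂ G V] [MeasurableSMul₂ G W] [StandardBorelSpace V]
    [StandardBorelSpace W] {q : W → V} (hq : IsGMap G q ρ α) (hρ : IsGSpace G ρ) {f : V → W}
    (hf : Measurable f) (hfq : ∀ᵐ w ∂ρ, f (q w) = w) : GIsomorphic G ρ α := by
  have hqm := hq.measurePreserving
  refine ⟨q, f, hq, ⟨⟨hf, ?_⟩, fun g => ?_⟩, hfq, ?_⟩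
  · rw [← hqm.map_eq, Measure.map_map hf hqm.measurable, Measure.map_congr (f := f ∘ q) (g := id) hfq,
      Measure.map_id]
  · have hm : MeasurableSet {v | f (g • v) = g • f v} :=
      measurableSet_eq_fun (hf.comp (measurable_const_smul g)) (hf.const_smul g)
    rw [← hqm.map_eq, ae_map_iff hqm.aemeasurable hm]
    filter_upwards [hfq, (hρ.quasiInvariant g).ae hfq, hq.equivariant g] with w h h' h''
    rw [← h'', h', h]
  · have hm : MeasurableSet {v | q (f v) = v} :=
      measurableSet_eq_fun (hqm.measurable.comp hf) measurable_id
    rw [← hqm.map_eq, ae_map_iff hqm.aemeasurable hm]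
    filter_upwards [hfq] with w h
    rw [h]

variable {ψ : W → X} {τ : W → Y} {π : X → Z} {φ : Y → Z}

/-- If `ψ` carries the fibre measures of `τ` to those of `π`, then the joint law of `(ψ, τ)` is the
independent relative joining. -/
theorem map_prodMk_eq_indepRelJoining [IsProbabilityMeasure ρ] [IsProbabilityMeasure η]
    [IsProbabilityMeasure ζ] (hψ : Measurable ψ) (hτ : Measurable τ) (hφ : Measurable φ)
    {Dτ : Kernel Y W} {Dπ : Kernel Z X} {Dφ : Kernel Z Y}
    [IsMarkovKernel Dπ] (hDτ : IsDisintegration τ ρ η Dτ) (hDφ : IsDisintegration φ η ζ Dφ)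
    (h : ∀ᵐ y ∂η, (Dτ y).map ψ = Dπ (φ y)) :
    ρ.map (fun w => (ψ w, τ w)) = indepRelJoining Dπ Dφ ζ := by
  have := hDτ.isMarkovKernel
  have := hDφ.isMarkovKernel
  have : IsFiniteMeasure (ρ.map (fun w => (ψ w, τ w))) := inferInstance
  refine Measure.ext_prod fun {A B} hA hB => ?_
  have hτm : Measurable (fun w => (τ w, w)) := hτ.prodMk measurable_id
  have hφm : Measurable (fun y => (φ y, y)) := hφ.prodMk measurable_id
  have hA' : Measurable (fun p : Z × Y => Dπ p.1 A) := (Dπ.measurable_coe hA).comp measurable_fst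
  calc ρ.map (fun w => (ψ w, τ w)) (A ×ˢ B)
      = ρ.map (fun w => (τ w, w)) (B ×ˢ (ψ ⁻¹' A)) := by
        rw [Measure.map_apply (hψ.prodMk hτ) (hA.prod hB),
          Measure.map_apply hτm (hB.prod (hψ hA))]
        congr 1
        ext w
        simp [and_comm]
    _ = ∫⁻ y in B, Dτ y (ψ ⁻¹' A) ∂η := by
        rw [← hDτ.compProd_eq hτ, Measure.compProd_apply_prod hB (hψ hA)]
    _ = ∫⁻ y in B, Dπ (φ y) A ∂η := by
        refine lintegral_congr_ae (ae_restrict_of_ae ?_)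
        filter_upwards [h] with y hy
        rw [← hy, Measure.map_apply hψ hA]
    _ = ∫⁻ p in Set.univ ×ˢ B, Dπ p.1 A ∂(η.map (fun y => (φ y, y))) := by
        rw [setLIntegral_map (MeasurableSet.univ.prod hB) hA' hφm]
        simp [Set.preimage]
    _ = ∫⁻ z, ∫⁻ _ in B, Dπ z A ∂(Dφ z) ∂ζ := by
        rw [← hDφ.compProd_eq hφ, Measure.setLIntegral_compProd hA' MeasurableSet.univ hB]
        simp
    _ = indepRelJoining Dπ Dφ ζ (A ×ˢ B) := by
        have hm : Measurable (fun z => (Dπ z).prod (Dφ z)) := by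
          simpa only [← Kernel.prod_apply] using (Dπ ×ₖ Dφ).measurable
        rw [indepRelJoining, Measure.bind_apply (hA.prod hB) hm.aemeasurable]
        simp [Measure.prod_prod]

/-- The fibre measures of `τ` are carried by `ψ` to those of `π`, when `τ` and `π` are relatively
measure-preserving and `φ` is relatively contractive. -/
theorem ae_map_eq_of_isRelContractive [TopologicalSpace G] [IsTopologicalGroup G]
    [LocallyCompactSpace G] [SecondCountableTopology G] [BorelSpace G]
    [MeasurableSMul₂ G X] [MeasurableSMul₂ G Y] [MeasurableSMul₂ G W]
    [StandardBorelSpace X] [MeasurableSingletonClass Z]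
    [IsProbabilityMeasure η] [IsProbabilityMeasure ζ]
    (hψ : IsGMap G ψ ρ ν) (hπ : IsGMap G π ν ζ) (hφ : IsGMap G φ η ζ)
    (hcomm : ∀ᵐ w ∂ρ, π (ψ w) = φ (τ w))
    (hτmp : IsRelMeasurePreserving G τ ρ η) (hπmp : IsRelMeasurePreserving G π ν ζ)
    (hφc : IsRelContractive G φ η ζ)
    {Dτ : Kernel Y W} {Dπ : Kernel Z X} {Dφ : Kernel Z Y} (hDτ : IsDisintegration τ ρ η Dτ)
    (hDπ : IsDisintegration π ν ζ Dπ) (hDφ : IsDisintegration φ η ζ Dφ) :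
    ∀ᵐ y ∂η, (Dτ y).map ψ = Dπ (φ y) := by
  have := hDτ.isMarkovKernel
  have := hDφ.isMarkovKernel
  have := hDπ.isMarkovKernel
  have hψm := hψ.measurePreserving.measurable
  have hπm := hπ.measurePreserving.measurable
  have hφm := hφ.measurePreserving.measurable
  have : IsMarkovKernel (Dτ.map ψ) := Kernel.IsMarkovKernel.map _ hψm
  -- By uniqueness this identifies the average of `ψ_* Dτ` over `Dφ z` as `Dπ z`. `hcomm` puts it on
  -- the right fibre.
  have hfib : IsDisintegration π ν ζ (Dτ.map ψ ∘ₖ Dφ) := by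
    refine ⟨inferInstance, ?_, ?_⟩
    · filter_upwards [hDφ.ae_eq_fibre, hDφ.ae_ae hDτ.ae_eq_fibre,
        hDφ.ae_ae (hDτ.ae_ae hcomm)] with z h₁ h₂ h₃
      have hm : MeasurableSet {x | π x = z} := hπm (measurableSet_singleton z)
      refine Kernel.ae_comp_of_ae_ae (p := fun x => π x = z) hm ?_
      filter_upwards [h₁, h₂, h₃] with y h₁ h₂ h₃
      rw [Kernel.map_apply _ hψm, ae_map_iff hψm.aemeasurable hm]
      filter_upwards [h₂, h₃] with w h₂ h₃
      rw [h₃, h₂, h₁]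
    · rw [← Measure.comp_assoc, hDφ.integral_eq, ← Measure.map_comp _ _ hψm, hDτ.integral_eq,
        hψ.measurePreserving.map_eq]
  have key := hφc.ae_eq_of_bind_eq hDφ (Dτ.map ψ) (Dπ.comap φ hφm) (fun g => ?_) (fun g => ?_) ?_
  · filter_upwards [key] with y hy
    rwa [Kernel.map_apply _ hψm, Kernel.comap_apply] at hy
  · filter_upwards [hτmp Dτ hDτ g, hDτ.ae_ae (hψ.equivariant g)] with y hy hy'
    rw [Kernel.map_apply _ hψm, Kernel.map_apply _ hψm, hy,
      Measure.map_map hψm (measurable_const_smul g), Measure.map_map (measurable_const_smul g) hψm]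
    exact Measure.map_congr hy'
  · filter_upwards [hφ.measurePreserving.quasiMeasurePreserving.ae (hπmp Dπ hDπ g),
      hφ.equivariant g] with y hy hy'
    rw [Kernel.comap_apply, Kernel.comap_apply, hy', hy]
  · filter_upwards [hfib.ae_unique hDπ hπm, hDφ.ae_eq_fibre] with z hz hz'
    rw [← Kernel.comp_apply, hz]
    have : (Dφ z).bind (Dπ.comap φ hφm) = (Dφ z).bind (fun _ => Dπ z) :=
      Measure.bind_congr_right (by
        filter_upwards [hz'] with y hy
        rw [Kernel.comap_apply, hy])
    rw [this, Measure.bind_const, measure_univ, one_smul]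

/-- Suppose `ψ` is relatively contractive, and that the `G`-map `q` through which it factors is
relatively measure-preserving. Then the disintegration over `q` is a family of point masses. -/
theorem ae_eq_dirac_of_isRelContractive [TopologicalSpace G] [IsTopologicalGroup G]
    [LocallyCompactSpace G] [SecondCountableTopology G] [BorelSpace G]
    [MeasurableSMul₂ G W] [StandardBorelSpace W] [MeasurableSingletonClass X]
    [IsProbabilityMeasure ν] [SFinite ρ] {q : W → V} {r : V → X}
    (hq : IsGMap G q ρ α) (hp : MeasurePreserving (r ∘ q) ρ ν)
    (hqmp : IsRelMeasurePreserving G q ρ α) (hc : IsRelContractive G (r ∘ q) ρ ν)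
    {D : Kernel V W} {Dp : Kernel X W} (hD : IsDisintegration q ρ α D)
    (hDp : IsDisintegration (r ∘ q) ρ ν Dp) :
    ∀ᵐ w ∂ρ, D (q w) = Measure.dirac w := by
  have := hD.isMarkovKernel
  have hqm := hq.measurePreserving.measurable
  -- `Kernel.id` is the family of point masses `w ↦ δ_w`, equivariant and with average `Dp x` over
  -- the fibre.
  have key := hc.ae_eq_of_bind_eq hDp (D.comap q hqm) Kernel.id (fun g => ?_) (fun g => ?_) ?_
  · filter_upwards [key] with w hw
    rwa [Kernel.comap_apply, Kernel.id_apply] at hw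
  · filter_upwards [hq.measurePreserving.quasiMeasurePreserving.ae (hqmp D hD g),
      hq.equivariant g] with w hw hw'
    rw [Kernel.comap_apply, Kernel.comap_apply, hw', hw]
  · refine Eventually.of_forall fun w => ?_
    rw [Kernel.id_apply, Kernel.id_apply, Measure.map_dirac' (measurable_const_smul g)]
  · filter_upwards [IsDisintegration.bind_comap_eq hq.measurePreserving hp hD hDp] with x hx
    rw [hx]
    exact Measure.bind_dirac.symm

end Joining

end GSpaces


/-- `X × Y` carries the diagonal action of `G`. -/
theorem corollaryC {G : Type*} [Group G] [TopologicalSpace G] [IsTopologicalGroup G]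
    [T2Space G] [LocallyCompactSpace G] [SecondCountableTopology G]
    [MeasurableSpace G] [BorelSpace G]
    {X Y Z W : Type*}
    [MeasurableSpace X] [StandardBorelSpace X] [MulAction G X]
    [MeasurableSpace Y] [StandardBorelSpace Y] [MulAction G Y]
    [MeasurableSpace Z] [StandardBorelSpace Z] [MulAction G Z]
    [MeasurableSpace W] [StandardBorelSpace W] [MulAction G W]
    (ν : Measure X) (η : Measure Y) (ζ : Measure Z) (ρ : Measure W)
    (hν : GSpaces.IsGSpace G ν) (hη : GSpaces.IsGSpace G η)
    (hζ : GSpaces.IsGSpace G ζ) (hρ : GSpaces.IsGSpace G ρ)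
    (ψ : W → X) (τ : W → Y) (π : X → Z) (φ : Y → Z)
    (hψ : GSpaces.IsGMap G ψ ρ ν) (hτ : GSpaces.IsGMap G τ ρ η)
    (hπ : GSpaces.IsGMap G π ν ζ) (hφ : GSpaces.IsGMap G φ η ζ)
    (hcomm : ∀ᵐ w ∂ρ, π (ψ w) = φ (τ w))
    (hτmp : GSpaces.IsRelMeasurePreserving G τ ρ η)
    (hπmp : GSpaces.IsRelMeasurePreserving G π ν ζ)
    (hψc : GSpaces.IsRelContractive G ψ ρ ν)
    (hφc : GSpaces.IsRelContractive G φ η ζ)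
    (Dπ : Kernel Z X) (Dφ : Kernel Z Y)
    (hDπ : GSpaces.IsDisintegration π ν ζ Dπ) (hDφ : GSpaces.IsDisintegration φ η ζ Dφ) :
    GSpaces.IsGSpace G (GSpaces.indepRelJoining Dπ Dφ ζ) ∧
      GSpaces.GIsomorphic G ρ (GSpaces.indepRelJoining Dπ Dφ ζ) := by

  have := hν.isProbabilityMeasure
  have := hη.isProbabilityMeasure
  have := hζ.isProbabilityMeasure
  have := hρ.isProbabilityMeasure
  have : MeasurableSMul₂ G X := ⟨hν.measurable_smul⟩
  have : MeasurableSMul₂ G Y := ⟨hη.measurable_smul⟩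
  have : MeasurableSMul₂ G W := ⟨hρ.measurable_smul⟩
  have : MeasurableSMul₂ G (X × Y) := ⟨by
    have hX : Measurable (fun p : G × (X × Y) => p.1 • p.2.1) := by fun_prop
    have hY : Measurable (fun p : G × (X × Y) => p.1 • p.2.2) := by fun_prop
    exact hX.prodMk hY⟩
  have : Nonempty W := nonempty_of_isProbabilityMeasure ρ
  have := hDπ.isMarkovKernel
  obtain ⟨Dτ, hDτ⟩ := GSpaces.exists_isDisintegration inferInstance hτ.measurePreserving
  obtain ⟨Dψ, hDψ⟩ := GSpaces.exists_isDisintegration inferInstance hψ.measurePreserving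
  have hlaw := GSpaces.map_prodMk_eq_indepRelJoining hψ.measurePreserving.measurable
    hτ.measurePreserving.measurable hφ.measurePreserving.measurable hDτ hDφ
    (GSpaces.ae_map_eq_of_isRelContractive hψ hπ hφ hcomm hτmp hπmp hφc hDτ hDπ hDφ)
  have hq : GSpaces.IsGMap G (fun w => (ψ w, τ w)) ρ (GSpaces.indepRelJoining Dπ Dφ ζ) := by
    refine ⟨⟨hψ.measurePreserving.measurable.prodMk hτ.measurePreserving.measurable, hlaw⟩,
      fun g => ?_⟩
    filter_upwards [hψ.equivariant g, hτ.equivariant g] with w h₁ h₂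
    rw [h₁, h₂, Prod.smul_mk]
  have hα := hq.isGSpace hρ
  have := hα.isProbabilityMeasure
  obtain ⟨D, hD⟩ := GSpaces.exists_isDisintegration inferInstance hq.measurePreserving
  have := hD.isMarkovKernel
  -- The map `q = (ψ, τ)` inherits measure preservation from `τ = Prod.snd ∘ q`; contractivity is
  -- then used for `ψ = Prod.fst ∘ q`.
  have hqmp := GSpaces.IsRelMeasurePreserving.of_comp (r := Prod.snd) hα.quasiInvariant
    hη.quasiInvariant hq hτ.measurePreserving hDτ hτmp
  have hdirac := GSpaces.ae_eq_dirac_of_isRelContractive (r := Prod.fst) hq hψ.measurePreserving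
    hqmp hψc hD hDψ
  obtain ⟨f, hf, hfD⟩ := GSpaces.exists_measurable_point D
  exact ⟨hα, hq.gIsomorphic hρ hf (hdirac.mono fun w hw => hfD _ _ hw)⟩
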